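/- Let $G$ be a word-hyperbolic group, and let $S$ be a finite generating set of $G$; thus, for some $\delta\ge 0$, all geodesic triangles of the Cayley graph of $(G,S)$ are $\delta$-slim. A subgroup $H\le G$ is called quasiconvex if there is $K$ such that every geodesic of this Cayley graph with endpoints in $H$ lies in the $K$-neighbourhood of $H$. A subgroup $H\le G$ is called separable if for every $g\in G\setminus H$ there is a finite-index subgroup $G'\le G$ with $H\subseteq G'$ and $g\notin G'$. Suppose that every quasiconvex subgroup of $G$ is separable. Let $H_1,\dots,H_M$ be residually finite quasiconvex subgroups of $G$ such that $H_i\cap H_j$ is finite whenever $i\neq j$. Then $\{H_1,\dots,H_M\}$ is relatively separable in $G$: for every finite collection of double cosets $H_{i_k}g_kH_{j_k}$ $(k=1,\dots,K$, $g_k\in G$, $i_k,j_k\in\{1,\dots,M\}$, where $i_k=j_k$ is allowed$)$, each of which is nontrivial in the sense that $H_{i_k}g_kH_{j_k}\neq H_{i_k}H_{j_k}$, there exists a finite-index subgroup $G'\le G$ with $$G'\cap H_{i_k}g_kH_{j_k}=\varnothing\qquad\text{for all } k=1,\dots,K.$$ -/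

import Mathlib

/-- A walk in a graph is geodesic if its length is the distance between its endpoints. -/
def IsGeodesicWalk {V : Type*} {X : SimpleGraph V} {x y : V} (p : X.Walk x y) : Prop :=
  p.length = X.dist x y

/-- A connected graph is (Gromov-)hyperbolic if, for some `δ`, all geodesic triangles are
`δ`-slim: each side is contained in the `δ`-neighbourhood of the union of the other two.
(The triangle is unordered: reversing and renaming the sides covers all three sides.) -/
def IsGromovHyperbolicGraph {V : Type*} (X : SimpleGraph V) : Prop :=
  ∃ δ : ℕ, ∀ (x y z : V) (p : X.Walk x y) (q : X.Walk y z) (r : X.Walk x z),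
    IsGeodesicWalk p → IsGeodesicWalk q → IsGeodesicWalk r →
    ∀ v ∈ p.support, ∃ u, (u ∈ q.support ∨ u ∈ r.support) ∧ X.dist v u ≤ δ

/-- `S` is a finite generating set of `G` whose Cayley graph is hyperbolic. -/
structure IsHyperbolicGeneratingSet {G : Type*} [Group G] (S : Set G) : Prop where
  finite : S.Finite
  closure_eq_top : Subgroup.closure S = ⊤
  hyperbolic : IsGromovHyperbolicGraph (SimpleGraph.mulCayley S)

/-- A subgroup `H` is quasiconvex (with respect to the generating set `S`) if, for some `K`,
every geodesic of the Cayley graph with both endpoints in `H` stays in the `K`-neighbourhood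
of `H`. -/
def IsQuasiconvexSubgroup {G : Type*} [Group G] (S : Set G) (H : Subgroup G) : Prop :=
  ∃ K : ℕ, ∀ x ∈ H, ∀ y ∈ H, ∀ p : (SimpleGraph.mulCayley S).Walk x y, IsGeodesicWalk p →
    ∀ v ∈ p.support, ∃ h ∈ H, (SimpleGraph.mulCayley S).dist v h ≤ K

/-- A subgroup `H` of `G` is separable if every `g ∉ H` can be excluded by a finite-index
subgroup containing `H`. -/
def IsSeparableSubgroup {G : Type*} [Group G] (H : Subgroup G) : Prop :=
  ∀ g : G, g ∉ H → ∃ G' : Subgroup G, G'.FiniteIndex ∧ H ≤ G' ∧ g ∉ G'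

/-- The double coset `A g B` is trivial if it equals the double coset `A 1 B = A B`. -/
def IsTrivialDoubleCoset {G : Type*} [Group G] (A B : Subgroup G) (g : G) : Prop :=
  DoubleCoset.doubleCoset g (A : Set G) (B : Set G) =
    DoubleCoset.doubleCoset 1 (A : Set G) (B : Set G)

/-- A collection of subgroups is relatively separable if every finite collection `C` of nontrivial
double cosets `H i * g * H j` is disjoint from some finite-index subgroup. -/
def IsRelativelySeparable {G ι : Type*} [Group G] (H : ι → Subgroup G) : Prop :=
  ∀ C : Finset (ι × ι × G),
    (∀ i j g, (i, j, g) ∈ C → ¬ IsTrivialDoubleCoset (H i) (H j) g) →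
    ∃ G' : Subgroup G, G'.FiniteIndex ∧ ∀ i j g, (i, j, g) ∈ C →
      Disjoint (G' : Set G) (DoubleCoset.doubleCoset g (H i : Set G) (H j : Set G))

namespace SimpleGraph

variable {V : Type*} {X : SimpleGraph V}

/-- Gromov's four-point condition for the graph metric, with constant `D`. -/
def FourPoint (X : SimpleGraph V) (D : ℕ) : Prop :=
  ∀ x y z w : V, X.dist x z + X.dist y w ≤ X.dist x y + X.dist z w + D ∨
    X.dist x z + X.dist y w ≤ X.dist y z + X.dist x w + D

/-- Every geodesic `[x, y]` passes within the Gromov product `(x|y)_w` of `w`, up to `D`. -/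
def GeodesicNear (X : SimpleGraph V) (D : ℕ) : Prop :=
  ∀ (x y w : V) (p : X.Walk x y), IsGeodesicWalk p →
    ∃ v ∈ p.support, 2 * X.dist w v + X.dist x y ≤ X.dist x w + X.dist w y + D

theorem dist_getVert_of_isGeodesicWalk (hX : X.Connected) {x y : V} {p : X.Walk x y}
    (hp : IsGeodesicWalk p) {i : ℕ} (hi : i ≤ p.length) :
    X.dist x (p.getVert i) = i ∧ X.dist (p.getVert i) y + i = X.dist x y := by
  have h1 := dist_le (p.take i)
  have h2 := dist_le (p.drop i)
  have h3 := hX.dist_triangle (u := x) (v := p.getVert i) (w := y)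
  rw [Walk.take_length] at h1
  rw [Walk.drop_length] at h2
  unfold IsGeodesicWalk at hp
  omega

theorem dist_add_dist_of_mem_support (hX : X.Connected) {x y v : V} {p : X.Walk x y}
    (hp : IsGeodesicWalk p) (hv : v ∈ p.support) :
    X.dist x v + X.dist v y = X.dist x y := by
  obtain ⟨n, rfl, hn⟩ := Walk.mem_support_iff_exists_getVert.1 hv
  have := dist_getVert_of_isGeodesicWalk hX hp hn
  omega

theorem exists_isGeodesicWalk (hX : X.Connected) (x y : V) :
    ∃ p : X.Walk x y, IsGeodesicWalk p :=
  hX.exists_walk_length_eq_dist x y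

/-- In a graph with slim triangles, the Gromov product approximates the distance to a side. -/
theorem geodesicNear_of_slim (hX : X.Connected) {δ : ℕ}
    (hδ : ∀ (x y z : V) (p : X.Walk x y) (q : X.Walk y z) (r : X.Walk x z),
      IsGeodesicWalk p → IsGeodesicWalk q → IsGeodesicWalk r →
      ∀ v ∈ p.support, ∃ u, (u ∈ q.support ∨ u ∈ r.support) ∧ X.dist v u ≤ δ) :
    GeodesicNear X (4 * δ + 2) := by
  classical
  intro x y w p hp
  obtain ⟨q, hq⟩ := exists_isGeodesicWalk hX y w
  obtain ⟨r, hr⟩ := exists_isGeodesicWalk hX x w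
  have hex : ∃ i, ∃ u ∈ q.support, X.dist (p.getVert i) u ≤ δ :=
    ⟨p.length, y, q.start_mem_support, by simp⟩
  obtain ⟨i, hi, hmin⟩ : ∃ i, (∃ u ∈ q.support, X.dist (p.getVert i) u ≤ δ) ∧
      ∀ j < i, ¬ ∃ u ∈ q.support, X.dist (p.getVert j) u ≤ δ :=
    ⟨Nat.find hex, Nat.find_spec hex, fun j hj => Nat.find_min hex hj⟩
  have hil : i ≤ p.length := by
    by_contra h
    exact hmin p.length (by omega) ⟨y, q.start_mem_support, by simp⟩
  obtain ⟨a, haq, ha⟩ := hi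
  obtain ⟨b, hbr, hb⟩ : ∃ b ∈ r.support, X.dist (p.getVert i) b ≤ δ + 1 := by
    rcases i with _ | i
    · exact ⟨x, r.start_mem_support, by simp⟩
    · obtain ⟨u, hu, hd⟩ := hδ x y w p q r hp hq hr _ (p.getVert_mem_support i)
      rcases hu with hu | hu
      · exact absurd ⟨u, hu, hd⟩ (hmin i (by omega))
      · refine ⟨u, hu, ?_⟩
        have h1 := dist_eq_one_iff_adj.2 (p.adj_getVert_succ (i := i) (by omega))
        have h2 := hX.dist_triangle (u := p.getVert (i + 1)) (v := p.getVert i) (w := u)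
        rw [dist_comm] at h1
        omega
  refine ⟨p.getVert i, p.getVert_mem_support i, ?_⟩
  have e1 := dist_add_dist_of_mem_support hX hq haq
  have e2 := dist_add_dist_of_mem_support hX hr hbr
  have e3 := dist_add_dist_of_mem_support hX hp (p.getVert_mem_support i)
  have t1 := hX.dist_triangle (u := p.getVert i) (v := a) (w := w)
  have t2 := hX.dist_triangle (u := p.getVert i) (v := a) (w := y)
  have t3 := hX.dist_triangle (u := p.getVert i) (v := b) (w := w)
  have t4 := hX.dist_triangle (u := p.getVert i) (v := b) (w := x)
  rw [X.dist_comm (u := w) (v := y), X.dist_comm (u := w) (v := p.getVert i)]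
  rw [X.dist_comm (u := a) (v := y)] at t2
  rw [X.dist_comm (u := b) (v := x), X.dist_comm (u := p.getVert i) (v := x)] at t4
  omega

theorem fourPoint_of_slim (hX : X.Connected) {δ : ℕ}
    (hδ : ∀ (x y z : V) (p : X.Walk x y) (q : X.Walk y z) (r : X.Walk x z),
      IsGeodesicWalk p → IsGeodesicWalk q → IsGeodesicWalk r →
      ∀ v ∈ p.support, ∃ u, (u ∈ q.support ∨ u ∈ r.support) ∧ X.dist v u ≤ δ) :
    FourPoint X (6 * δ + 2) := by
  intro x y z w
  obtain ⟨p, hp⟩ := exists_isGeodesicWalk hX x z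
  obtain ⟨q, hq⟩ := exists_isGeodesicWalk hX z y
  obtain ⟨r, hr⟩ := exists_isGeodesicWalk hX x y
  obtain ⟨v, hv, hvd⟩ := geodesicNear_of_slim hX hδ x z w p hp
  obtain ⟨u, hu, hud⟩ := hδ x z y p q r hp hq hr v hv
  have t0 := hX.dist_triangle (u := w) (v := v) (w := u)
  have t1 := hX.dist_triangle (u := w) (v := u) (w := y)
  rw [X.dist_comm (u := y) (v := w), X.dist_comm (u := z) (v := w), X.dist_comm (u := y) (v := z)]
  rcases hu with hu | hu
  · right
    have e := dist_add_dist_of_mem_support hX hq hu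
    have t2 := hX.dist_triangle (u := w) (v := u) (w := z)
    rw [X.dist_comm (u := u) (v := z)] at t2
    omega
  · left
    have e := dist_add_dist_of_mem_support hX hr hu
    have t2 := hX.dist_triangle (u := w) (v := u) (w := x)
    rw [X.dist_comm (u := u) (v := x), X.dist_comm (u := w) (v := x)] at t2
    omega

/-- A broken geodesic with vertices `x 0, …, x n` whose Gromov products at the corners are at most
`C / 2` and whose interior pieces are longer than `L`. -/
structure IsBrokenGeodesic (X : SimpleGraph V) (C L : ℕ) (x : ℕ → V) (n : ℕ) : Prop where
  corner : ∀ i, i + 2 ≤ n →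
    X.dist (x i) (x (i + 1)) + X.dist (x (i + 1)) (x (i + 2)) ≤ X.dist (x i) (x (i + 2)) + C
  long : ∀ i, 1 ≤ i → i + 2 ≤ n → L < X.dist (x i) (x (i + 1))

namespace IsBrokenGeodesic

variable {C D L n : ℕ} {x : ℕ → V}

theorem reverse (h : IsBrokenGeodesic X C L x n) :
    IsBrokenGeodesic X C L (fun i => x (n - i)) n where
  corner i hi := by
    have := h.corner (n - (i + 2)) (by omega)
    rw [show n - (i + 2) + 1 = n - (i + 1) by omega, show n - (i + 2) + 2 = n - i by omega] at this
    rw [X.dist_comm (u := x (n - i)) (v := x (n - (i + 1))),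
      X.dist_comm (u := x (n - (i + 1))) (v := x (n - (i + 2))),
      X.dist_comm (u := x (n - i)) (v := x (n - (i + 2)))]
    omega
  long i h1 hi := by
    have := h.long (n - (i + 1)) (by omega) (by omega)
    rw [show n - (i + 1) + 1 = n - i by omega] at this
    rwa [X.dist_comm]

theorem forward (h : IsBrokenGeodesic X C L x n) (hX : FourPoint X D) (hL : C + D ≤ L) (k : ℕ)
    (hk : k + 2 ≤ n) :
    X.dist (x 0) (x (k + 1)) + X.dist (x (k + 1)) (x (k + 2)) ≤
      X.dist (x 0) (x (k + 2)) + C + D := by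
  induction k with
  | zero => have := h.corner 0 hk; simp only [zero_add] at this ⊢; omega
  | succ k ih =>
    have ih := ih (by omega)
    have hc := h.corner (k + 1) hk
    have hl := h.long (k + 1) (by omega) (by omega)
    have h4 := hX (x (k + 1)) (x 0) (x (k + 3)) (x (k + 2))
    simp only [add_assoc, Nat.reduceAdd] at *
    rw [X.dist_comm (u := x (k + 1)) (v := x 0), X.dist_comm (u := x (k + 3)) (v := x (k + 2))] at h4
    omega

theorem backward (h : IsBrokenGeodesic X C L x n) (hX : FourPoint X D) (hL : C + D ≤ L) (k : ℕ)
    (hk : k + 2 ≤ n) :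
    X.dist (x k) (x (k + 1)) + X.dist (x (k + 1)) (x n) ≤ X.dist (x k) (x n) + C + D := by
  have := h.reverse.forward hX hL (n - (k + 2)) (by omega)
  simp only [show n - (n - (k + 2) + 1) = k + 1 by omega, show n - (n - (k + 2) + 2) = k by omega,
    Nat.sub_zero] at this
  rw [X.dist_comm (u := x k) (v := x (k + 1)), X.dist_comm (u := x (k + 1)) (v := x n),
    X.dist_comm (u := x k) (v := x n)]
  omega

theorem middle (h : IsBrokenGeodesic X C L x n) (hX : FourPoint X D) (hL : 2 * C + 3 * D ≤ L)
    (k : ℕ) (hk : k + 2 ≤ n) :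
    X.dist (x 0) (x (k + 1)) + X.dist (x (k + 1)) (x n) ≤ X.dist (x 0) (x n) + C + 2 * D := by
  have hf := h.forward hX (by omega) k hk
  rcases hk.eq_or_lt with rfl | hlt
  · omega
  have hb := h.backward hX (by omega) (k + 1) (by omega)
  have hl := h.long (k + 1) (by omega) (by omega)
  have h4 := hX (x 0) (x n) (x (k + 2)) (x (k + 1))
  simp only [add_assoc, Nat.reduceAdd] at *
  rw [X.dist_comm (u := x n) (v := x (k + 1)), X.dist_comm (u := x (k + 2)) (v := x (k + 1)),
    X.dist_comm (u := x n) (v := x (k + 2))] at h4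
  omega

theorem lt_dist (h : IsBrokenGeodesic X C L x n) (hX : FourPoint X D) (hL : C + D ≤ L)
    (hn : 3 ≤ n) : L < X.dist (x 0) (x n) + 2 * C + 2 * D := by
  obtain ⟨m, rfl⟩ := Nat.exists_eq_add_of_le' hn
  have h1 := h.forward hX hL (m + 1) (by omega)
  have h2 := h.forward hX hL m (by omega)
  have h3 := h.long (m + 1) (by omega) (by omega)
  simp only [add_assoc, Nat.reduceAdd] at *
  omega

theorem exists_near (h : IsBrokenGeodesic X C L x n) (hX : FourPoint X D) (hc : X.Connected)
    (hL : 2 * C + 3 * D ≤ L) (hn : 1 ≤ n) {v : V}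
    (hv : X.dist (x 0) v + X.dist v (x n) = X.dist (x 0) (x n)) :
    ∃ k < n, X.dist (x k) v + X.dist v (x (k + 1)) ≤
      X.dist (x k) (x (k + 1)) + (C + 5 * D) := by
  classical
  have hex : ∃ k, k + 1 ≤ n ∧ X.dist (x 0) v + X.dist v (x (k + 1)) ≤
      X.dist (x 0) (x (k + 1)) + D :=
    ⟨n - 1, by omega, by rw [show n - 1 + 1 = n by omega]; omega⟩
  obtain ⟨k, ⟨hkn, hk⟩, hmin⟩ : ∃ k, (k + 1 ≤ n ∧ X.dist (x 0) v + X.dist v (x (k + 1)) ≤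
      X.dist (x 0) (x (k + 1)) + D) ∧ ∀ j < k, ¬ (j + 1 ≤ n ∧
        X.dist (x 0) v + X.dist v (x (j + 1)) ≤ X.dist (x 0) (x (j + 1)) + D) :=
    ⟨Nat.find hex, Nat.find_spec hex, fun j hj => Nat.find_min hex hj⟩
  rcases k with _ | j
  · exact ⟨0, hkn, by simp only [zero_add] at *; omega⟩
  refine ⟨j + 1, by omega, ?_⟩
  have hj : ¬ (X.dist (x 0) v + X.dist v (x (j + 1)) ≤ X.dist (x 0) (x (j + 1)) + D) :=
    fun h => hmin j (by omega) ⟨by omega, h⟩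
  have h1 := hX (x 0) (x (j + 1)) (x n) v
  have h2 := hX (x 0) (x (j + 1)) (x (j + 2)) v
  have hm := h.middle hX hL j (by omega)
  have ht := hc.dist_triangle (u := v) (v := x (j + 1)) (w := x (j + 2))
  simp only [add_assoc, Nat.reduceAdd] at *
  rw [X.dist_comm (u := x (j + 1)) (v := v), X.dist_comm (u := x n) (v := v)] at h1
  rw [X.dist_comm (u := x (j + 1)) (v := v), X.dist_comm (u := x (j + 2)) (v := v)] at h2
  rw [X.dist_comm (u := x (j + 1)) (v := v)]
  omega

end IsBrokenGeodesic

end SimpleGraph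

section CayleyGraph

open SimpleGraph

variable {G : Type*} [Group G] {S : Set G}

theorem mulCayley_connected (hS : Subgroup.closure S = ⊤) : (mulCayley S).Connected := by
  have htrans : ∀ g x y : G, (mulCayley S).Reachable x y →
      (mulCayley S).Reachable (g * x) (g * y) := by
    rintro g x y ⟨p⟩
    exact ⟨p.map (⟨(g * ·), fun h => (mulCayley_adj_mul_iff_right).2 h⟩ :
      mulCayley S →g mulCayley S)⟩
  have key : ∀ g : G, (mulCayley S).Reachable 1 g := by
    intro g
    have hg : g ∈ Subgroup.closure S := hS ▸ Subgroup.mem_top g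
    induction hg using Subgroup.closure_induction with
    | mem x hx =>
      by_cases h1 : (1 : G) = x
      · exact h1 ▸ Reachable.refl _
      · exact Adj.reachable ((mulCayley_adj S 1 x).2 ⟨h1, Or.inl (by simpa using hx)⟩)
    | one => exact Reachable.refl _
    | mul x y _ _ hx hy =>
      have := htrans x 1 y hy
      rw [mul_one] at this
      exact hx.trans this
    | inv x _ hx =>
      have := htrans x⁻¹ 1 x hx
      rw [mul_one, inv_mul_cancel] at this
      exact this.symm
  exact (connected_iff _).2 ⟨fun x y => (key x).symm.trans (key y), ⟨1⟩⟩

theorem mulCayley_dist_mul_left (hX : (mulCayley S).Connected) (g x y : G) :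
    (mulCayley S).dist (g * x) (g * y) = (mulCayley S).dist x y := by
  have key : ∀ g x y : G, (mulCayley S).dist (g * x) (g * y) ≤ (mulCayley S).dist x y := by
    intro g x y
    obtain ⟨p, hp⟩ := hX.exists_walk_length_eq_dist x y
    have := dist_le (p.map (⟨(g * ·), fun h => (mulCayley_adj_mul_iff_right).2 h⟩ :
      mulCayley S →g mulCayley S))
    rw [Walk.length_map, hp] at this
    exact this
  refine le_antisymm (key g x y) ?_
  simpa using key g⁻¹ (g * x) (g * y)

theorem mulCayley_dist_eq (hX : (mulCayley S).Connected) (x y : G) :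
    (mulCayley S).dist x y = (mulCayley S).dist 1 (x⁻¹ * y) := by
  rw [← mulCayley_dist_mul_left hX x⁻¹ x y, inv_mul_cancel]

theorem mulCayley_finite_ball (hX : (mulCayley S).Connected) (hS : S.Finite) (R : ℕ) :
    {g : G | (mulCayley S).dist 1 g ≤ R}.Finite := by
  induction R with
  | zero =>
    refine (Set.finite_singleton (1 : G)).subset fun g hg => ?_
    exact (hX.dist_eq_zero_iff.1 (Nat.le_zero.1 hg)).symm
  | succ R ih =>
    refine (ih.union (ih.mul (hS.union hS.inv))).subset fun g hg => ?_
    rcases Nat.lt_or_ge R ((mulCayley S).dist 1 g) with h | h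
    · right
      obtain ⟨p, hp⟩ := exists_isGeodesicWalk hX 1 g
      have hl : p.length = R + 1 := le_antisymm (hp.le.trans hg) (hp ▸ h)
      have h1 := dist_getVert_of_isGeodesicWalk hX hp (i := R) (by omega)
      have h2 := p.adj_getVert_succ (i := R) (by omega)
      rw [← hl, p.getVert_length, mulCayley_adj] at h2
      refine ⟨p.getVert R, h1.1.le, (p.getVert R)⁻¹ * g, ?_, mul_inv_cancel_left _ _⟩
      rcases h2.2 with h | h
      · exact Or.inl h
      · exact Or.inr (by simpa using h)
    · exact Or.inl h

/-- Points with small Gromov product with respect to `1` and an element of a quasiconvex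
subgroup are close to that subgroup. -/
theorem IsQuasiconvexSubgroup.exists_near {H : Subgroup G} (hH : IsQuasiconvexSubgroup S H)
    (hX : (mulCayley S).Connected) {D : ℕ} (hD : GeodesicNear (mulCayley S) D) (E : ℕ) :
    ∃ K : ℕ, ∀ h ∈ H, ∀ v, (mulCayley S).dist 1 v + (mulCayley S).dist v h ≤
      (mulCayley S).dist 1 h + E → ∃ h' ∈ H, (mulCayley S).dist v h' ≤ K := by
  obtain ⟨K, hK⟩ := hH
  refine ⟨D + E + K, fun h hh v hv => ?_⟩
  obtain ⟨p, hp⟩ := exists_isGeodesicWalk hX 1 h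
  obtain ⟨u, hu, hud⟩ := hD 1 h v p hp
  obtain ⟨h', hh', hd⟩ := hK 1 H.one_mem h hh p hp u hu
  refine ⟨h', hh', ?_⟩
  have := hX.dist_triangle (u := v) (v := u) (w := h')
  omega

/-- Two quasiconvex subgroups with finite intersection have bounded Gromov products. -/
theorem exists_gromovProduct_bound {A B : Subgroup G} (hX : (mulCayley S).Connected)
    (hS : S.Finite) {D : ℕ} (h4 : FourPoint (mulCayley S) D) (hD : GeodesicNear (mulCayley S) D)
    (hA : IsQuasiconvexSubgroup S A) (hB : IsQuasiconvexSubgroup S B)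
    (hAB : ((A ⊓ B : Subgroup G) : Set G).Finite) :
    ∃ C : ℕ, ∀ a ∈ A, ∀ b ∈ B, (mulCayley S).dist a 1 + (mulCayley S).dist 1 b ≤
      (mulCayley S).dist a b + C := by
  obtain ⟨KA, hKA⟩ := hA.exists_near hX hD 0
  obtain ⟨KB, hKB⟩ := hB.exists_near hX hD D
  have hfin : (⋃ u ∈ {u : G | (mulCayley S).dist 1 u ≤ KA + KB},
      {x : G | x ∈ A ∧ x * u ∈ B}).Finite := by
    refine (mulCayley_finite_ball hX hS _).biUnion fun u _ => ?_
    by_cases hne : ∃ x₀, x₀ ∈ A ∧ x₀ * u ∈ B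
    · obtain ⟨x₀, hx₀, hx₀u⟩ := hne
      refine (hAB.image (· * x₀)).subset ?_
      rintro x ⟨hx, hxu⟩
      refine ⟨x * x₀⁻¹, ⟨A.mul_mem hx (A.inv_mem hx₀), ?_⟩, by simp⟩
      have := B.mul_mem hxu (B.inv_mem hx₀u)
      simpa [mul_assoc] using this
    · convert Set.finite_empty
      ext x
      simpa using fun hx hxu => hne ⟨x, hx, hxu⟩
  obtain ⟨R, hR⟩ := (hfin.image fun x => (mulCayley S).dist 1 x).bddAbove
  refine ⟨2 * (R + KA) + 1, fun a ha b hb => ?_⟩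
  by_contra hcon
  rw [not_le, dist_comm (u := a) (v := 1)] at hcon
  have t1 := hX.dist_triangle (u := a) (v := b) (w := 1)
  have t2 := hX.dist_triangle (u := 1) (v := a) (w := b)
  rw [dist_comm (u := a) (v := 1), dist_comm (u := b) (v := 1)] at t1
  obtain ⟨p, hp⟩ := exists_isGeodesicWalk hX 1 a
  obtain ⟨hv1, hv2⟩ := dist_getVert_of_isGeodesicWalk hX hp (i := R + KA + 1)
    (by rw [show p.length = _ from hp]; omega)
  set v := p.getVert (R + KA + 1)
  obtain ⟨x, hx, hvx⟩ := hKA a ha v (by omega)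
  obtain ⟨y, hy, hvy⟩ := hKB b hb v (by
    have := h4 v a b 1
    rw [dist_comm (u := v) (v := 1), dist_comm (u := b) (v := 1), dist_comm (u := a) (v := 1)]
      at this
    omega)
  have hxR : (mulCayley S).dist 1 x ≤ R := by
    refine hR ⟨x, Set.mem_biUnion (x := x⁻¹ * y) ?_ ⟨hx, by simpa using hy⟩, rfl⟩
    have := hX.dist_triangle (u := x) (v := v) (w := y)
    rw [dist_comm (u := x) (v := v)] at this
    change (mulCayley S).dist 1 (x⁻¹ * y) ≤ _
    rw [← mulCayley_dist_eq hX]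
    omega
  have := hX.dist_triangle (u := 1) (v := x) (w := v)
  rw [dist_comm (u := x) (v := v)] at this
  omega

end CayleyGraph

section Group

variable {G : Type*} [Group G]

/-- A finite-index subgroup has finitely many coset representatives on either side. -/
theorem exists_finite_coset_representatives {A' A : Subgroup G}
    (hfi : (A'.subgroupOf A).FiniteIndex) :
    ∃ T : Set G, T.Finite ∧ T ⊆ A ∧ ∀ a ∈ A, ∃ a' ∈ A', a'⁻¹ * a ∈ T := by
  refine ⟨Set.range fun q : A ⧸ A'.subgroupOf A => ((q.out : A) : G)⁻¹, Set.finite_range _, ?_, ?_⟩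
  · rintro _ ⟨q, rfl⟩
    exact A.inv_mem q.out.2
  · intro a ha
    obtain ⟨h, hh⟩ := QuotientGroup.mk_out_eq_mul (A'.subgroupOf A) (⟨a, ha⟩⁻¹ : A)
    refine ⟨((h : A) : G), Subgroup.mem_subgroupOf.1 h.2,
      ((⟨a, ha⟩⁻¹ : A) : A ⧸ A'.subgroupOf A), ?_⟩
    simp only [hh]
    simp

theorem exists_finiteIndex_forall_mem_eq_one [Group.ResiduallyFinite G] {F : Set G}
    (hF : F.Finite) : ∃ N : Subgroup G, N.FiniteIndex ∧ ∀ x ∈ F, x ∈ N → x = 1 := by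
  induction F, hF using Set.Finite.induction_on with
  | empty => exact ⟨⊤, inferInstance, by simp⟩
  | @insert a s _ _ ih =>
    obtain ⟨N, hN, h⟩ := ih
    by_cases ha : a = 1
    · exact ⟨N, hN, by rintro x (rfl | hx) hxN; exacts [ha, h x hx hxN]⟩
    · obtain ⟨N', hN', haN'⟩ :=
        Group.residuallyFinite_iff_exists_finiteIndex.1 ‹_› a ha
      exact ⟨N ⊓ N', inferInstance, by
        rintro x (rfl | hx) hxN
        exacts [absurd hxN.2 haN', h x hx hxN.1]⟩

theorem exists_finiteIndex_subgroup_forall_notMem {A : Subgroup G}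
    (hA : Group.ResiduallyFinite A) {F : Set G} (hF : F.Finite) :
    ∃ A' ≤ A, (A'.subgroupOf A).FiniteIndex ∧ ∀ a ∈ A', a ≠ 1 → a ∉ F := by
  obtain ⟨N, hN, h⟩ := exists_finiteIndex_forall_mem_eq_one
    (hF.preimage (f := ((↑) : A → G)) Subtype.val_injective.injOn)
  refine ⟨N.map A.subtype, Subgroup.map_subtype_le N, ?_, ?_⟩
  · rwa [Subgroup.subgroupOf, Subgroup.comap_map_eq_self_of_injective A.subtype_injective]
  · rintro _ ⟨a, ha, rfl⟩ hne haF
    exact hne (by rw [h a haF ha]; rfl)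

theorem IsSeparableSubgroup.exists_finiteIndex_disjoint {K : Subgroup G}
    (hK : IsSeparableSubgroup K) {P : Set G} (hP : P.Finite) (hPK : ∀ p ∈ P, p ∉ K) :
    ∃ G' : Subgroup G, G'.FiniteIndex ∧ K ≤ G' ∧ ∀ p ∈ P, p ∉ G' := by
  induction P, hP using Set.Finite.induction_on with
  | empty => exact ⟨⊤, inferInstance, le_top, by simp⟩
  | @insert a s _ _ ih =>
    obtain ⟨N, hN, hKN, h⟩ := ih fun p hp => hPK p (Or.inr hp)
    obtain ⟨N', hN', hKN', h'⟩ := hK a (hPK a (Or.inl rfl))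
    refine ⟨N ⊓ N', inferInstance, le_inf hKN hKN', ?_⟩
    rintro x (rfl | hx) hxN
    exacts [h' hxN.2, h x hx hxN.1]

theorem Subgroup.exists_list_of_mem_sup {A B : Subgroup G} {g : G} (hg : g ∈ A ⊔ B) :
    ∃ l : List G, (∀ x ∈ l, x ∈ A ∨ x ∈ B) ∧ l.prod = g := by
  rw [Subgroup.sup_eq_closure] at hg
  induction hg using Subgroup.closure_induction with
  | mem x hx => exact ⟨[x], by simpa using hx, by simp⟩
  | one => exact ⟨[], by simp, rfl⟩
  | mul x y _ _ hx hy =>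
    obtain ⟨l, hl, rfl⟩ := hx
    obtain ⟨m, hm, rfl⟩ := hy
    exact ⟨l ++ m, fun z hz => (List.mem_append.1 hz).elim (hl z) (hm z), by simp⟩
  | inv x _ hx =>
    obtain ⟨l, hl, rfl⟩ := hx
    refine ⟨(l.map (·⁻¹)).reverse, fun z hz => ?_, by rw [List.prod_inv_reverse]⟩
    simp only [List.mem_reverse, List.mem_map] at hz
    obtain ⟨y, hy, rfl⟩ := hz
    simpa using hl y hy

/-- A shortest word in the elements of `A` and `B` among those with the same product. -/
def IsReducedWord (A B : Subgroup G) (l : List G) : Prop :=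
  (∀ x ∈ l, x ∈ A ∨ x ∈ B) ∧
    ∀ l' : List G, (∀ x ∈ l', x ∈ A ∨ x ∈ B) → l'.prod = l.prod → l.length ≤ l'.length

/-- Consecutive letters of a list come from `A` and `B` in alternation. -/
def IsAlternating (A B : Subgroup G) (l : List G) : Prop :=
  l.IsChain fun x y => (x ∈ A ∧ y ∈ B) ∨ (x ∈ B ∧ y ∈ A)

theorem exists_isReducedWord {A B : Subgroup G} {g : G} (hg : g ∈ A ⊔ B) :
    ∃ l, IsReducedWord A B l ∧ l.prod = g := by
  obtain ⟨l, ⟨hl, hlg⟩, hmin⟩ := (measure (List.length (α := G))).wf.has_min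
    {l | (∀ x ∈ l, x ∈ A ∨ x ∈ B) ∧ l.prod = g} (Subgroup.exists_list_of_mem_sup hg)
  exact ⟨l, ⟨hl, fun l' h1 h2 => not_lt.1 (hmin l' ⟨h1, h2.trans hlg⟩)⟩, hlg⟩

namespace IsReducedWord

variable {A B : Subgroup G}

theorem tail {x : G} {l : List G} (h : IsReducedWord A B (x :: l)) : IsReducedWord A B l := by
  refine ⟨fun y hy => h.1 y (List.mem_cons_of_mem _ hy), fun l' h1 h2 => ?_⟩
  have := h.2 (x :: l') (by
    rintro y (_ | ⟨_, hy⟩)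
    exacts [h.1 _ List.mem_cons_self, h1 y hy]) (by simp [h2])
  simpa using this

theorem ne_one {l : List G} (h : IsReducedWord A B l) : ∀ x ∈ l, x ≠ 1 := by
  induction l with
  | nil => simp
  | cons y l ih =>
    rintro x (_ | ⟨_, hx⟩)
    · rintro rfl
      have := h.2 l h.tail.1 (by simp)
      simp at this
    · exact ih h.tail x hx

theorem isAlternating {l : List G} (h : IsReducedWord A B l) : IsAlternating A B l := by
  induction l with
  | nil => exact List.isChain_nil
  | cons x l ih =>
    rcases l with _ | ⟨y, l⟩
    · exact List.isChain_singleton _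
    refine List.isChain_cons_cons.2 ⟨?_, ih h.tail⟩
    have hmerge : ¬ (x * y ∈ A ∨ x * y ∈ B) := fun hxy => by
      have := h.2 (x * y :: l) (by
        rintro z (_ | ⟨_, hz⟩)
        exacts [hxy, h.tail.tail.1 z hz]) (by simp [mul_assoc])
      simp at this
    rcases h.1 x (by simp) with hx | hx <;> rcases h.1 y (by simp) with hy | hy
    · exact absurd (Or.inl (A.mul_mem hx hy)) hmerge
    · exact Or.inl ⟨hx, hy⟩
    · exact Or.inr ⟨hx, hy⟩
    · exact absurd (Or.inr (B.mul_mem hx hy)) hmerge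

end IsReducedWord

end Group

section DoubleCosets

open SimpleGraph

variable {G : Type*} [Group G] {S : Set G}

theorem IsQuasiconvexSubgroup.of_finiteIndex {A' A : Subgroup G} (hA : IsQuasiconvexSubgroup S A)
    (hX : (mulCayley S).Connected) (hle : A' ≤ A) (hfi : (A'.subgroupOf A).FiniteIndex) :
    IsQuasiconvexSubgroup S A' := by
  obtain ⟨K, hK⟩ := hA
  obtain ⟨T, hT, -, hTA⟩ := exists_finite_coset_representatives hfi
  obtain ⟨R, hR⟩ := (hT.image fun x => (mulCayley S).dist 1 x).bddAbove
  refine ⟨K + R, fun x hx y hy p hp v hv => ?_⟩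
  obtain ⟨a, ha, hva⟩ := hK x (hle hx) y (hle hy) p hp v hv
  obtain ⟨a', ha', haT⟩ := hTA a ha
  refine ⟨a', ha', ?_⟩
  have h1 : (mulCayley S).dist a a' ≤ R := by
    rw [dist_comm, mulCayley_dist_eq hX]
    exact hR ⟨_, haT, rfl⟩
  have := hX.dist_triangle (u := v) (v := a) (w := a')
  omega

/-- The partial products of an alternating word with long interior letters form a broken
geodesic. -/
theorem IsAlternating.isBrokenGeodesic {A B : Subgroup G} {C L : ℕ} {l : List G}
    (h : IsAlternating A B l) (hX : (mulCayley S).Connected)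
    (hC : ∀ a ∈ A, ∀ b ∈ B, (mulCayley S).dist a 1 + (mulCayley S).dist 1 b ≤
      (mulCayley S).dist a b + C)
    (hL : ∀ i (hi : i + 2 ≤ l.length), 1 ≤ i → L < (mulCayley S).dist 1 l[i]) (g : G) :
    IsBrokenGeodesic (mulCayley S) C L (fun i => g * (l.take i).prod) l.length := by
  have hstep : ∀ i (hi : i < l.length),
      g * (l.take (i + 1)).prod = (g * (l.take i).prod) * l[i] := fun i hi => by
    rw [List.prod_take_succ l i hi, mul_assoc]
  constructor
  · intro i hi
    rw [show i + 2 = (i + 1) + 1 from rfl, hstep (i + 1) hi, hstep i (by omega)]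
    set x := g * (l.take i).prod
    have key : (mulCayley S).dist l[i]⁻¹ 1 + (mulCayley S).dist 1 l[i + 1] ≤
        (mulCayley S).dist l[i]⁻¹ l[i + 1] + C := by
      rcases List.isChain_iff_getElem.1 h i hi with ⟨h1, h2⟩ | ⟨h1, h2⟩
      · exact hC _ (A.inv_mem h1) _ h2
      · have := hC _ h2 _ (B.inv_mem h1)
        rw [dist_comm (u := l[i]⁻¹) (v := 1), dist_comm (u := 1) (v := l[i + 1]),
          dist_comm (u := l[i]⁻¹) (v := l[i + 1])]
        omega
    rw [← mulCayley_dist_mul_left hX (x * l[i]) _ 1, ← mulCayley_dist_mul_left hX (x * l[i]) 1,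
      ← mulCayley_dist_mul_left hX (x * l[i]) l[i]⁻¹] at key
    simpa using key
  · intro i h1 hi
    rw [hstep i (by omega)]
    have := hL i hi h1
    rwa [← mulCayley_dist_mul_left hX (g * (l.take i).prod), mul_one] at this

theorem isQuasiconvexSubgroup_sup {A B : Subgroup G} {C D L : ℕ} (hX : (mulCayley S).Connected)
    (h4 : FourPoint (mulCayley S) D) (hD : GeodesicNear (mulCayley S) D)
    (hA : IsQuasiconvexSubgroup S A) (hB : IsQuasiconvexSubgroup S B)
    (hC : ∀ a ∈ A, ∀ b ∈ B, (mulCayley S).dist a 1 + (mulCayley S).dist 1 b ≤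
      (mulCayley S).dist a b + C)
    (hL : 2 * C + 3 * D ≤ L)
    (hlA : ∀ a ∈ A, a ≠ 1 → L < (mulCayley S).dist 1 a)
    (hlB : ∀ b ∈ B, b ≠ 1 → L < (mulCayley S).dist 1 b) :
    IsQuasiconvexSubgroup S (A ⊔ B) := by
  obtain ⟨KA, hKA⟩ := hA.exists_near hX hD (C + 5 * D)
  obtain ⟨KB, hKB⟩ := hB.exists_near hX hD (C + 5 * D)
  have hle : ∀ a, a ∈ A ∨ a ∈ B → a ∈ A ⊔ B := fun a ha =>
    ha.elim (fun h => le_sup_left (a := A) h) (fun h => le_sup_right (b := B) h)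
  have hnear : ∀ g ∈ A ⊔ B, ∀ a, a ∈ A ∨ a ∈ B → ∀ v, (mulCayley S).dist g v +
      (mulCayley S).dist v (g * a) ≤ (mulCayley S).dist g (g * a) + (C + 5 * D) →
      ∃ h ∈ A ⊔ B, (mulCayley S).dist v h ≤ max KA KB := by
    intro g hg a ha v hv
    rw [← mulCayley_dist_mul_left hX g⁻¹ g v, ← mulCayley_dist_mul_left hX g⁻¹ v,
      ← mulCayley_dist_mul_left hX g⁻¹ g (g * a), inv_mul_cancel, inv_mul_cancel_left] at hv
    obtain ⟨h, hh, hd⟩ : ∃ h, (h ∈ A ∨ h ∈ B) ∧ (mulCayley S).dist (g⁻¹ * v) h ≤ max KA KB := by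
      rcases ha with ha | ha
      · obtain ⟨h, hh, hd⟩ := hKA a ha _ hv
        exact ⟨h, Or.inl hh, hd.trans (le_max_left _ _)⟩
      · obtain ⟨h, hh, hd⟩ := hKB a ha _ hv
        exact ⟨h, Or.inr hh, hd.trans (le_max_right _ _)⟩
    refine ⟨g * h, mul_mem hg (hle h hh), ?_⟩
    rwa [← mulCayley_dist_mul_left hX g, mul_inv_cancel_left] at hd
  refine ⟨max KA KB, fun x hx y hy p hp v hv => ?_⟩
  have hxy := dist_add_dist_of_mem_support hX hp hv
  obtain ⟨l, hl, hlp⟩ := exists_isReducedWord (mul_mem (inv_mem hx) hy)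
  rcases Nat.eq_zero_or_pos l.length with h0 | hpos
  · obtain rfl := List.length_eq_zero_iff.1 h0
    obtain rfl : x = y := by simpa [eq_inv_mul_iff_mul_eq] using hlp
    exact hnear x hx 1 (Or.inl A.one_mem) v (by rw [mul_one]; omega)
  have hbg := hl.isAlternating.isBrokenGeodesic hX hC (L := L) (fun i hi _ => by
    have hm : l[i] ∈ l := List.getElem_mem _
    exact (hl.1 _ hm).elim (fun h => hlA _ h (hl.ne_one _ hm))
      (fun h => hlB _ h (hl.ne_one _ hm))) x
  obtain ⟨k, hk, hkv⟩ := hbg.exists_near h4 hX hL hpos (v := v) (by simpa [hlp] using hxy)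
  simp only [List.prod_take_succ l k hk, ← mul_assoc] at hkv
  refine hnear (x * (l.take k).prod) (mul_mem hx ?_) l[k] (hl.1 _ (List.getElem_mem _)) v hkv
  exact Subgroup.list_prod_mem _ fun z hz => hle z (hl.1 z (List.mem_of_mem_take hz))

/-- Every element of `A * (A' ⊔ B') * B` either lies in `A * B` or is the product of an alternating
word of length at least three whose interior letters are nontrivial and lie in `A'` or `B'`. -/
theorem exists_isAlternating_of_mem_sup {A B A' B' : Subgroup G} (hA : A' ≤ A) (hB : B' ≤ B)
    {a k b : G} (ha : a ∈ A) (hk : k ∈ A' ⊔ B') (hb : b ∈ B) :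
    (∃ a' ∈ A, ∃ b' ∈ B, a * k * b = a' * b') ∨
    ∃ l : List G, IsAlternating A B l ∧ 3 ≤ l.length ∧ l.prod = a * k * b ∧
      ∀ i (hi : i + 2 ≤ l.length), 1 ≤ i → l[i] ≠ 1 ∧ (l[i] ∈ A' ∨ l[i] ∈ B') := by
  obtain ⟨l₀, hl₀, hl₀k⟩ := Subgroup.exists_list_of_mem_sup hk
  obtain ⟨⟨a₁, l, b₁⟩, ⟨ha₁, hb₁, hl, hprod⟩, hmin⟩ :=
    (measure fun t : G × List G × G => t.2.1.length).wf.has_min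
      {t | t.1 ∈ A ∧ t.2.2 ∈ B ∧ (∀ x ∈ t.2.1, x ∈ A' ∨ x ∈ B') ∧
        t.1 * t.2.1.prod * t.2.2 = a * k * b}
      ⟨(a, l₀, b), ha, hb, hl₀, by rw [hl₀k]⟩
  replace hmin : ∀ (a₂ : G) (l₂ : List G) (b₂ : G), a₂ ∈ A → b₂ ∈ B → (∀ x ∈ l₂, x ∈ A' ∨ x ∈ B') →
      a₂ * l₂.prod * b₂ = a * k * b → l.length ≤ l₂.length := fun a₂ l₂ b₂ h1 h2 h3 h4 =>
    not_lt.1 (hmin (a₂, l₂, b₂) ⟨h1, h2, h3, h4⟩)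
  simp only at ha₁ hb₁ hl hprod
  have hred : IsReducedWord A' B' l :=
    ⟨hl, fun l' h1 h2 => hmin a₁ l' b₁ ha₁ hb₁ h1 (by rw [h2, hprod])⟩
  rcases List.eq_nil_or_concat l with rfl | ⟨l₁, y, rfl⟩
  · exact Or.inl ⟨a₁, ha₁, b₁, hb₁, by simpa using hprod.symm⟩
  right
  rw [List.concat_eq_append] at *
  have hy : y ∈ A := by
    refine hA ((hl y (by simp)).resolve_right fun h => ?_)
    have := hmin a₁ l₁ (y * b₁) ha₁ (B.mul_mem (hB h) hb₁) (fun x hx => hl x (by simp [hx]))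
      (by rw [← hprod]; simp [mul_assoc])
    simp at this
  have hx : ∀ x ∈ (l₁ ++ [y]).head?, x ∈ B := by
    intro x hx
    obtain ⟨l₂, hl₂⟩ : ∃ l₂, l₁ ++ [y] = x :: l₂ :=
      ⟨_, (List.cons_head?_tail hx).symm⟩
    rw [hl₂] at hl hprod hmin
    refine hB ((hl x (by simp)).resolve_left fun h => ?_)
    have := hmin (a₁ * x) l₂ b₁ (A.mul_mem ha₁ (hA h)) hb₁ (fun x hx => hl x (by simp [hx]))
      (by rw [← hprod]; simp [mul_assoc])
    simp at this
  refine ⟨a₁ :: ((l₁ ++ [y]) ++ [b₁]), ?_, by simp, by rw [← hprod]; simp [mul_assoc], ?_⟩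
  · refine List.isChain_cons.2 ⟨?_, List.isChain_append.2 ⟨?_, List.isChain_singleton _, ?_⟩⟩
    · intro x hx'
      refine Or.inl ⟨ha₁, hx x ?_⟩
      rwa [List.head?_append_of_ne_nil _ (by simp)] at hx'
    · exact hred.isAlternating.imp fun u v h =>
        h.imp (fun h => ⟨hA h.1, hB h.2⟩) fun h => ⟨hB h.1, hA h.2⟩
    · intro u hu v hv
      simp only [List.getLast?_append, List.getLast?_singleton, Option.some_or, Option.mem_def,
        Option.some.injEq, List.head?_cons] at hu hv
      subst hu hv
      exact Or.inl ⟨hy, hb₁⟩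
  · intro i hi h1
    obtain ⟨j, rfl⟩ := Nat.exists_eq_add_of_le' h1
    have hj : j < (l₁ ++ [y]).length := by simp at hi ⊢; omega
    have hm : (a₁ :: ((l₁ ++ [y]) ++ [b₁]))[j + 1] ∈ l₁ ++ [y] := by
      rw [List.getElem_cons_succ, List.getElem_append_left hj]
      exact List.getElem_mem _
    exact ⟨hred.ne_one _ hm, hl _ hm⟩

theorem exists_finiteIndex_disjoint_doubleCoset (hS : IsHyperbolicGeneratingSet S)
    (hG : ∀ H : Subgroup G, IsQuasiconvexSubgroup S H → IsSeparableSubgroup H)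
    {A B : Subgroup G} (hrA : Group.ResiduallyFinite A) (hrB : Group.ResiduallyFinite B)
    (hA : IsQuasiconvexSubgroup S A) (hB : IsQuasiconvexSubgroup S B)
    (hAB : ((A ⊓ B : Subgroup G) : Set G).Finite) {g : G}
    (hg : ∀ a ∈ A, ∀ b ∈ B, g ≠ a * b) :
    ∃ G' : Subgroup G, G'.FiniteIndex ∧ ∀ a ∈ A, ∀ b ∈ B, a * g * b ∉ G' := by
  have hX := mulCayley_connected hS.closure_eq_top
  obtain ⟨δ, hδ⟩ := hS.hyperbolic
  obtain ⟨D, h4, hD⟩ : ∃ D, FourPoint (mulCayley S) D ∧ GeodesicNear (mulCayley S) D := by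
    refine ⟨6 * δ + 2, fourPoint_of_slim hX hδ, fun x y w p hp => ?_⟩
    obtain ⟨v, hv, hd⟩ := geodesicNear_of_slim hX hδ x y w p hp
    exact ⟨v, hv, by omega⟩
  obtain ⟨C, hC⟩ := exists_gromovProduct_bound hX hS.finite h4 hD hA hB hAB
  have hball := mulCayley_finite_ball hX hS.finite
    (2 * C + 3 * D + (mulCayley S).dist 1 g)
  obtain ⟨A', hA'A, hfA, hlA⟩ := exists_finiteIndex_subgroup_forall_notMem hrA hball
  obtain ⟨B', hB'B, hfB, hlB⟩ := exists_finiteIndex_subgroup_forall_notMem hrB hball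
  replace hlA : ∀ a ∈ A', a ≠ 1 → 2 * C + 3 * D + (mulCayley S).dist 1 g < (mulCayley S).dist 1 a :=
    fun a ha hne => not_le.1 (hlA a ha hne)
  replace hlB : ∀ b ∈ B', b ≠ 1 → 2 * C + 3 * D + (mulCayley S).dist 1 g < (mulCayley S).dist 1 b :=
    fun b hb hne => not_le.1 (hlB b hb hne)
  have hK := hG _ (isQuasiconvexSubgroup_sup hX h4 hD (hA.of_finiteIndex hX hA'A hfA)
    (hB.of_finiteIndex hX hB'B hfB) (fun a ha b hb => hC a (hA'A ha) b (hB'B hb))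
    (Nat.le_add_right _ _) hlA hlB)
  have hgK : ∀ a ∈ A, ∀ b ∈ B, a * g * b ∉ A' ⊔ B' := by
    intro a ha b hb hmem
    have hprod : a⁻¹ * (a * g * b) * b⁻¹ = g := by group
    rcases exists_isAlternating_of_mem_sup hA'A hB'B (A.inv_mem ha) hmem (B.inv_mem hb) with
      ⟨a', ha', b', hb', h⟩ | ⟨l, hl, hlen, hlp, hlong⟩
    · exact hg a' ha' b' hb' (hprod ▸ h)
    · have := (hl.isBrokenGeodesic hX hC (fun i hi h1 =>
        (hlong i hi h1).2.elim (fun h => hlA _ h (hlong i hi h1).1)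
          fun h => hlB _ h (hlong i hi h1).1) 1).lt_dist h4 (by omega) hlen
      simp only [List.take_zero, List.prod_nil, mul_one, one_mul, List.take_length, hlp,
        hprod] at this
      omega
  obtain ⟨T, hT, hTA, hTr⟩ := exists_finite_coset_representatives hfA
  obtain ⟨U, hU, hUB, hUr⟩ := exists_finite_coset_representatives hfB
  obtain ⟨G', hG', hKG', hmiss⟩ := hK.exists_finiteIndex_disjoint
    (hT.image2 (fun t u => t * g * u⁻¹) hU) (by
      rintro _ ⟨t, ht, u, hu, rfl⟩
      exact hgK t (hTA ht) _ (B.inv_mem (hUB hu)))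
  refine ⟨G', hG', fun a ha b hb hmem => ?_⟩
  obtain ⟨a', ha', hat⟩ := hTr a ha
  obtain ⟨b', hb', hbu⟩ := hUr b⁻¹ (B.inv_mem hb)
  refine hmiss _ ⟨_, hat, _, hbu, rfl⟩ ?_
  have h1 := G'.mul_mem (G'.mul_mem (G'.inv_mem (hKG' (le_sup_left (a := A') ha'))) hmem)
    (hKG' (le_sup_right (b := B') hb'))
  convert h1 using 1
  group

end DoubleCosets

theorem proposition2p5 {G : Type*} [Group G] (S : Set G) (hS : IsHyperbolicGeneratingSet S)
    (hG : ∀ H : Subgroup G, IsQuasiconvexSubgroup S H → IsSeparableSubgroup H)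
    (M : ℕ) (H : Fin M → Subgroup G)
    (hrf : ∀ i, Group.ResiduallyFinite (H i))
    (hqc : ∀ i, IsQuasiconvexSubgroup S (H i))
    (hfin : ∀ i j, i ≠ j → ((H i ⊓ H j : Subgroup G) : Set G).Finite) :
    IsRelativelySeparable H := by
  intro C hC
  have key : ∀ c : C, ∃ G' : Subgroup G, G'.FiniteIndex ∧
      ∀ a ∈ H c.1.1, ∀ b ∈ H c.1.2.1, a * c.1.2.2 * b ∉ G' := by
    rintro ⟨⟨i, j, g⟩, hc⟩
    have hg : ∀ a ∈ H i, ∀ b ∈ H j, g ≠ a * b := fun a ha b hb h =>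
      hC i j g hc (DoubleCoset.doubleCoset_eq_of_mem
        (DoubleCoset.mem_doubleCoset.2 ⟨a, ha, b, hb, by rw [mul_one, h]⟩))
    rcases eq_or_ne i j with rfl | hij
    · obtain ⟨G', hG', hle, hgG'⟩ := hG _ (hqc i) g fun h => hg g h 1 (one_mem _) (by simp)
      refine ⟨G', hG', fun a ha b hb hmem => hgG' ?_⟩
      rwa [G'.mul_mem_cancel_right (hle hb), G'.mul_mem_cancel_left (hle ha)] at hmem
    · exact exists_finiteIndex_disjoint_doubleCoset hS hG (hrf i) (hrf j) (hqc i) (hqc j)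
        (hfin i j hij) hg
  choose G' hG' hdisj using key
  refine ⟨⨅ c, G' c, Subgroup.finiteIndex_iInf hG', fun i j g hc => ?_⟩
  refine Set.disjoint_left.2 fun x hx hxd => ?_
  obtain ⟨a, ha, b, hb, rfl⟩ := DoubleCoset.mem_doubleCoset.1 hxd
  exact hdisj ⟨_, hc⟩ a ha b hb (Subgroup.mem_iInf.1 hx _)
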